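/- Let $M\ge 1$, let $\Sigma_S$ be a real symmetric positive semidefinite $M\times M$ matrix, and let $P\ge 0$ and $c\in\mathbb R$. In the $M$-user "Carbon Copying onto Dirty Paper" (CCDP) channel with state gain $c$, the real-valued outputs over $N$ channel uses are $$Y_m^N = X^N + c\,S_m^N + Z_m^N ,\qquad m=1,\dots,M,$$ where each $Z_m^N$ is an i.i.d. $\mathcal N(0,1)$ sequence, the vectors $(S_{1,n},\dots,S_{M,n})$, $n=1,\dots,N$, are i.i.d. $\mathcal N(0,\Sigma_S)$, and each noise sequence is independent of the states. A code of length $N$ with $K$ messages consists of a (measurable) encoder, which maps a message $W$, uniform on $K$ values and independent of states and noise, together with all the state sequences $(S_1^N,\dots,S_M^N)$ (known non-causally) to an input $X^N\in\mathbb R^N$ with $\sum_{n=1}^N\mathbb E|X_n|^2\le NP$, and of $M$ (measurable) decoders, the $m$-th of which estimates $W$ from $Y_m^N$ alone. A rate $R\ge 0$ is achievable if for every $\varepsilon>0$ and all sufficiently large $N$ there is such a code with $K\ge 2^{NR}$ messages whose error probability is at most $\varepsilon$ at each of the $M$ receivers. The capacity $\mathcal C(c)\in[0,\infty]$, for fixed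 $\Sigma_S$ and $P$, is the supremum of the achievable rates. Then the capacity is non-increasing in the magnitude of the state gain: $$|c_1|\le |c_2| \quad\Longrightarrow\quad \mathcal C(c_2)\le \mathcal C(c_1).$$ In particular, $\mathcal C$ is non-increasing on $[0,\infty)$. -/

import Mathlib

open MeasureTheory ProbabilityTheory
open scoped ENNReal

namespace CCDP

/-- Law of the state sequences of the `M` users over `N` channel uses: the vectors
`(S_{1,n}, …, S_{M,n})`, `n = 1, …, N`, are i.i.d. `𝒩(0, Σ)`.
The state of user `m` at time `n` is `s n m`. -/
noncomputable def stateLaw {M : ℕ} (Sig : Matrix (Fin M) (Fin M) ℝ) (N : ℕ) :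
    Measure (Fin N → EuclideanSpace ℝ (Fin M)) :=
  Measure.pi fun _ => multivariateGaussian 0 Sig

/-- Law of the noise sequence of one receiver: i.i.d. `𝒩(0, 1)`. -/
noncomputable def noiseLaw (N : ℕ) : Measure (Fin N → ℝ) :=
  Measure.pi fun _ => gaussianReal 0 1

/-- Output sequence of receiver `m` for input `x`, states `s` and noise `z`:
`Y_m^N = X^N + c S_m^N + Z_m^N`. -/
def output {M N : ℕ} (c : ℝ) (m : Fin M) (x : Fin N → ℝ)
    (s : Fin N → EuclideanSpace ℝ (Fin M)) (z : Fin N → ℝ) : Fin N → ℝ :=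
  fun n => x n + c * s n m + z n

/-- A block code of length `N` with `K` messages for `M` receivers. The encoder sees the message and
all the state sequences in their entirety (non-causally); receiver `m` sees only its own output
sequence. -/
structure Code (M N K : ℕ) where
  enc : Fin K → (Fin N → EuclideanSpace ℝ (Fin M)) → (Fin N → ℝ)
  dec : Fin M → (Fin N → ℝ) → Fin K
  measurable_enc : ∀ w, Measurable (enc w)
  measurable_dec : ∀ m, Measurable (dec m)

namespace Code

variable {M N K : ℕ}

/-- Expected energy `∑ₙ E |Xₙ|²` of the channel input, over the uniform message and the states. -/
noncomputable def energy (C : Code M N K) (Sig : Matrix (Fin M) (Fin M) ℝ) : ℝ≥0∞ :=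
  (∑ w : Fin K, ∑ n : Fin N, ∫⁻ s, ENNReal.ofReal (|C.enc w s n| ^ 2) ∂(stateLaw Sig N)) / K

/-- Probability that receiver `m` decodes a wrong message, for the uniform message and gain `c`. The
states and the noise of receiver `m` are independent. (The dependence between the noises of
different receivers does not enter.) -/
noncomputable def errorProb (C : Code M N K) (Sig : Matrix (Fin M) (Fin M) ℝ) (c : ℝ)
    (m : Fin M) : ℝ :=
  (∑ w : Fin K, ((stateLaw Sig N).prod (noiseLaw N)).real
    {q | C.dec m (output c m (C.enc w q.1) q.1 q.2) ≠ w}) / K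

end Code

/-- The rate `R` (in bits per channel use) is achievable: for every `ε > 0` and all large block
lengths `N` there is a code with at least `2 ^ (N R)` messages that obeys the average power
constraint and whose error probability is at most `ε` at every receiver. -/
def Achievable {M : ℕ} (Sig : Matrix (Fin M) (Fin M) ℝ) (P c R : ℝ) : Prop :=
  ∀ ε : ℝ, 0 < ε → ∃ N₀ : ℕ, ∀ N : ℕ, N₀ ≤ N →
    ∃ (K : ℕ) (C : Code M N K), (2 : ℝ) ^ ((N : ℝ) * R) ≤ (K : ℝ) ∧
      C.energy Sig ≤ ENNReal.ofReal (N * P) ∧ ∀ m : Fin M, C.errorProb Sig c m ≤ ε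

/-- The capacity: the supremum, in `[0, ∞]`, of the achievable rates. -/
noncomputable def capacity {M : ℕ} (Sig : Matrix (Fin M) (Fin M) ℝ) (P c : ℝ) : ℝ≥0∞ :=
  sSup (ENNReal.ofReal '' {R : ℝ | 0 ≤ R ∧ Achievable Sig P c R})

end CCDP

namespace CCDP

/-! Write c₁ = a c₂ with |a| ≤ 1 and choose b with a² + b² = 1. If T is an independent copy of the
states S, shared by encoder and receivers, then aS + bT has the law of S. A code for gain c₂ can
thus be run on aS + bT over the channel with gain c₁, each receiver adding c₂bT to its output;
averaged over T, energy and errors are unchanged.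

T is then fixed. Energy and all M errors must be controlled by one value of T, so a weighted sum is
averaged (`exists_shift_le`). The errors weigh heavily, so only a factor 1 + δ is lost in energy;
unused channel uses (`pad`) restore the power constraint at an arbitrarily small cost in rate. -/

/-- If `a ^ 2 + b ^ 2 = 1`, then `a • X + b • Y` has the law of `X` when `X`, `Y` are independent
centred Gaussian vectors with the same covariance. -/
theorem measurePreserving_smul_add_smul_multivariateGaussian {M : ℕ}
    {Sig : Matrix (Fin M) (Fin M) ℝ} (hSig : Sig.PosSemidef) {a b : ℝ} (hab : a ^ 2 + b ^ 2 = 1) :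
    MeasurePreserving (fun p : EuclideanSpace ℝ (Fin M) × EuclideanSpace ℝ (Fin M) =>
        a • p.1 + b • p.2)
      ((multivariateGaussian 0 Sig).prod (multivariateGaussian 0 Sig))
      (multivariateGaussian 0 Sig) where
  measurable := by fun_prop
  map_eq := by
    set μ := multivariateGaussian (0 : EuclideanSpace ℝ (Fin M)) Sig with hμ
    have h1 : (μ.prod μ).map (fun p => a • p.1 + b • p.2)
        = (μ.map (a • ·)).conv (μ.map (b • ·)) := by
      rw [Measure.conv, Measure.map_prod_map _ _ (by fun_prop) (by fun_prop),
        Measure.map_map (by fun_prop) (by fun_prop)]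
      rfl
    have := Measure.isProbabilityMeasure_map (μ := μ) (f := (a • ·)) (by fun_prop)
    have := Measure.isProbabilityMeasure_map (μ := μ) (f := (b • ·)) (by fun_prop)
    rw [h1]
    -- Both exponents are multiples of one quadratic form, with factors a² and b² that sum to 1.
    refine Measure.ext_of_charFun ?_
    ext x
    rw [charFun_conv, charFun_map_smul, charFun_map_smul, hμ, charFun_multivariateGaussian hSig,
      charFun_multivariateGaussian hSig, charFun_multivariateGaussian hSig, ← Complex.exp_add]
    congr 1
    have hC : (a : ℂ) ^ 2 + (b : ℂ) ^ 2 = 1 := by exact_mod_cast hab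
    simp only [inner_zero_right, Complex.ofReal_zero, zero_mul, zero_sub, WithLp.ofLp_smul,
      Matrix.mulVec_smul, dotProduct_smul, smul_dotProduct, smul_eq_mul, Complex.ofReal_mul]
    linear_combination (-(((x.ofLp ⬝ᵥ Sig.mulVec x.ofLp : ℝ) : ℂ)) / 2) * hC

instance {M : ℕ} (Sig : Matrix (Fin M) (Fin M) ℝ) (N : ℕ) :
    IsProbabilityMeasure (stateLaw Sig N) := by
  unfold stateLaw; infer_instance

instance (N : ℕ) : IsProbabilityMeasure (noiseLaw N) := by
  unfold noiseLaw; infer_instance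

theorem measurePreserving_smul_add_smul_stateLaw {M : ℕ} {Sig : Matrix (Fin M) (Fin M) ℝ}
    (hSig : Sig.PosSemidef) {a b : ℝ} (hab : a ^ 2 + b ^ 2 = 1) (N : ℕ) :
    MeasurePreserving (fun p : (Fin N → EuclideanSpace ℝ (Fin M)) ×
        (Fin N → EuclideanSpace ℝ (Fin M)) => a • p.1 + b • p.2)
      ((stateLaw Sig N).prod (stateLaw Sig N)) (stateLaw Sig N) := by
  have h1 := measurePreserving_pi
    (fun _ : Fin N => (multivariateGaussian 0 Sig).prod (multivariateGaussian 0 Sig))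
    (fun _ : Fin N => multivariateGaussian 0 Sig)
    (fun _ => measurePreserving_smul_add_smul_multivariateGaussian hSig hab)
  have h2 := (measurePreserving_arrowProdEquivProdArrow (EuclideanSpace ℝ (Fin M))
    (EuclideanSpace ℝ (Fin M)) (Fin N) (fun _ => multivariateGaussian 0 Sig)
    (fun _ => multivariateGaussian 0 Sig)).symm
  exact h1.comp h2

/-- The first `n` coordinates of `n + k` i.i.d. variables are `n` i.i.d. variables. -/
theorem measurePreserving_comp_castAdd {α : Type*} [MeasurableSpace α] (μ : Measure α)
    [IsProbabilityMeasure μ] (n k : ℕ) :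
    MeasurePreserving (fun (s : Fin (n + k) → α) (i : Fin n) => s (Fin.castAdd k i))
      (Measure.pi fun _ => μ) (Measure.pi fun _ => μ) where
  measurable := by fun_prop
  map_eq := by
    symm
    refine Measure.pi_eq fun s hs => ?_
    rw [Measure.map_apply (by fun_prop) (MeasurableSet.univ_pi hs)]
    have : (fun (x : Fin (n + k) → α) (i : Fin n) => x (Fin.castAdd k i)) ⁻¹' Set.univ.pi s
        = Set.univ.pi (Fin.addCases s fun _ => Set.univ) := by
      ext x
      simp only [Set.mem_preimage, Set.mem_univ_pi]
      refine ⟨fun h i => ?_, fun h i => by simpa using h (Fin.castAdd k i)⟩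
      refine Fin.addCases (fun i => ?_) (fun i => ?_) i
      · simpa using h i
      · simp
    rw [this, Measure.pi_pi, Fin.prod_univ_add]
    simp

/-- The output is jointly measurable in states and noise. -/
theorem measurable_output {M N : ℕ} (c : ℝ) (m : Fin M)
    {f : (Fin N → EuclideanSpace ℝ (Fin M)) → Fin N → ℝ} (hf : Measurable f) :
    Measurable fun q : (Fin N → EuclideanSpace ℝ (Fin M)) × (Fin N → ℝ) =>
      output c m (f q.1) q.1 q.2 := by
  unfold output
  fun_prop

/-! ### Codes: conditioning on the states, shifting, padding. -/

namespace Code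

variable {M N K : ℕ}

/-- Energy of the input for the state sequence `s`, averaged over the message. -/
noncomputable def energyAt (C : Code M N K) (s : Fin N → EuclideanSpace ℝ (Fin M)) : ℝ≥0∞ :=
  (∑ w : Fin K, ∑ n : Fin N, ENNReal.ofReal (|C.enc w s n| ^ 2)) / K

/-- Error probability at receiver `m` for the state sequence `s`. -/
noncomputable def errorAt (C : Code M N K) (c : ℝ) (m : Fin M)
    (s : Fin N → EuclideanSpace ℝ (Fin M)) : ℝ≥0∞ :=
  (∑ w : Fin K, noiseLaw N {z | C.dec m (output c m (C.enc w s) s z) ≠ w}) / K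

theorem measurableSet_error (C : Code M N K) (c : ℝ) (m : Fin M) (w : Fin K) :
    MeasurableSet {q : (Fin N → EuclideanSpace ℝ (Fin M)) × (Fin N → ℝ) |
      C.dec m (output c m (C.enc w q.1) q.1 q.2) ≠ w} :=
  ((C.measurable_dec m).comp (measurable_output c m (C.measurable_enc w)))
    (MeasurableSet.singleton w).compl

theorem measurable_energyAt (C : Code M N K) : Measurable C.energyAt := by
  have := C.measurable_enc
  unfold energyAt
  fun_prop

theorem measurable_noiseLaw_error (C : Code M N K) (c : ℝ) (m : Fin M) (w : Fin K) :
    Measurable fun s => noiseLaw N {z | C.dec m (output c m (C.enc w s) s z) ≠ w} :=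
  measurable_measure_prodMk_left (C.measurableSet_error c m w)

theorem measurable_errorAt (C : Code M N K) (c : ℝ) (m : Fin M) : Measurable (C.errorAt c m) := by
  have := C.measurable_noiseLaw_error c m
  unfold errorAt
  fun_prop

theorem energy_eq_lintegral (C : Code M N K) (Sig : Matrix (Fin M) (Fin M) ℝ) :
    C.energy Sig = ∫⁻ s, C.energyAt s ∂stateLaw Sig N := by
  have := C.measurable_enc
  simp only [energy, energyAt, div_eq_mul_inv]
  rw [lintegral_mul_const _ (by fun_prop), lintegral_finsetSum _ (by fun_prop)]
  congr 1
  exact Finset.sum_congr rfl fun w _ => (lintegral_finsetSum _ (by fun_prop)).symm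

theorem ofReal_errorProb_eq_lintegral (C : Code M N K) (Sig : Matrix (Fin M) (Fin M) ℝ) (c : ℝ)
    (m : Fin M) : ENNReal.ofReal (C.errorProb Sig c m) = ∫⁻ s, C.errorAt c m s ∂stateLaw Sig N := by
  have := C.measurable_noiseLaw_error c m
  simp only [errorAt, div_eq_mul_inv]
  rw [lintegral_mul_const _ (by fun_prop), lintegral_finsetSum _ (by fun_prop)]
  -- For K = 0 the sums are empty and both sides are 0.
  rcases Nat.eq_zero_or_pos K with rfl | hK
  · simp [errorProb]
  rw [errorProb, ENNReal.ofReal_div_of_pos (by exact_mod_cast hK),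
    ENNReal.ofReal_sum_of_nonneg fun _ _ => measureReal_nonneg, ENNReal.ofReal_natCast,
    div_eq_mul_inv]
  congr 1
  refine Finset.sum_congr rfl fun w _ => ?_
  rw [ofReal_measureReal, Measure.prod_apply (C.measurableSet_error c m w)]
  rfl

/-- The code run on the states `a • s + τ`, where the fixed sequence `τ` is known to everybody:
each receiver adds `c τ` to its output. -/
noncomputable def shift (C : Code M N K) (c a : ℝ) (τ : Fin N → EuclideanSpace ℝ (Fin M)) :
    Code M N K where
  enc w s := C.enc w (a • s + τ)
  dec m y := C.dec m fun n => y n + c * τ n m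
  measurable_enc w := (C.measurable_enc w).comp (by fun_prop)
  measurable_dec m := (C.measurable_dec m).comp (by fun_prop)

theorem energyAt_shift (C : Code M N K) (c a : ℝ) (τ s : Fin N → EuclideanSpace ℝ (Fin M)) :
    (C.shift c a τ).energyAt s = C.energyAt (a • s + τ) := rfl

/-- Since c(as + τ) = (ac)s + cτ, adding cτ turns the output at gain ac into the output at gain c
for the states as + τ, with the same noise. -/
theorem errorAt_shift (C : Code M N K) (c a : ℝ) (m : Fin M)
    (τ s : Fin N → EuclideanSpace ℝ (Fin M)) :
    (C.shift c a τ).errorAt (a * c) m s = C.errorAt c m (a • s + τ) := by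
  have h (w : Fin K) (z : Fin N → ℝ) :
      (fun n => output (a * c) m (C.enc w (a • s + τ)) s z n + c * τ n m)
        = output c m (C.enc w (a • s + τ)) (a • s + τ) z := by
    ext n
    simp only [output, Pi.add_apply, Pi.smul_apply, PiLp.add_apply, PiLp.smul_apply, smul_eq_mul]
    ring
  simp only [errorAt, shift, h]

/-- The code followed by `k` channel uses without input, which the receivers ignore. -/
noncomputable def pad (C : Code M N K) (k : ℕ) : Code M (N + k) K where
  enc w s := Fin.addCases (C.enc w fun i => s (Fin.castAdd k i)) fun _ => 0
  dec m y := C.dec m fun i => y (Fin.castAdd k i)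
  measurable_enc w := by
    have := C.measurable_enc w
    refine measurable_pi_iff.2 fun i => Fin.addCases (fun i => ?_) (fun i => ?_) i
    · simp only [Fin.addCases_left]
      fun_prop
    · simp only [Fin.addCases_right]
      fun_prop
  measurable_dec m := (C.measurable_dec m).comp (by fun_prop)

theorem energy_pad (C : Code M N K) (k : ℕ) (Sig : Matrix (Fin M) (Fin M) ℝ) :
    (C.pad k).energy Sig = C.energy Sig := by
  rw [energy_eq_lintegral, energy_eq_lintegral]
  have h := (measurePreserving_comp_castAdd (multivariateGaussian 0 Sig) N k).lintegral_comp
    C.measurable_energyAt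
  refine Eq.trans (lintegral_congr fun s => ?_) h
  simp [energyAt, pad, Fin.sum_univ_add]

theorem errorProb_pad (C : Code M N K) (k : ℕ) (Sig : Matrix (Fin M) (Fin M) ℝ) (c : ℝ)
    (m : Fin M) : (C.pad k).errorProb Sig c m = C.errorProb Sig c m := by
  have h := (measurePreserving_comp_castAdd (multivariateGaussian 0 Sig) N k).prod
    (measurePreserving_comp_castAdd (gaussianReal 0 1) N k)
  unfold errorProb
  congr 1
  refine Finset.sum_congr rfl fun w _ => ?_
  refine Eq.trans (congrArg _ ?_)
    (h.measureReal_preimage (C.measurableSet_error c m w).nullMeasurableSet)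
  ext q
  have hout : (fun i => output c m ((C.pad k).enc w q.1) q.1 q.2 (Fin.castAdd k i))
      = output c m (C.enc w fun i => q.1 (Fin.castAdd k i)) (fun i => q.1 (Fin.castAdd k i))
        fun i => q.2 (Fin.castAdd k i) := by
    ext i
    simp [pad, output]
  exact not_congr (iff_of_eq (congrArg (C.dec m · = w) hout))

/-- Fixing the common randomness: some shift of the code does as well as the code itself, with
respect to a weighted sum of energy and error probabilities. -/
theorem exists_shift_le (C : Code M N K) {Sig : Matrix (Fin M) (Fin M) ℝ} (hSig : Sig.PosSemidef)
    (c : ℝ) {a b : ℝ} (hab : a ^ 2 + b ^ 2 = 1) (κ lam : ℝ≥0∞) :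
    ∃ D : Code M N K,
      κ * D.energy Sig + lam * ∑ m, ENNReal.ofReal (D.errorProb Sig (a * c) m)
        ≤ κ * C.energy Sig + lam * ∑ m, ENNReal.ofReal (C.errorProb Sig c m) := by
  have hE (D : Code M N K) (c : ℝ) :
      κ * D.energy Sig + lam * ∑ m, ENNReal.ofReal (D.errorProb Sig c m)
        = ∫⁻ s, (κ * D.energyAt s + lam * ∑ m, D.errorAt c m s) ∂stateLaw Sig N := by
    have h1 := D.measurable_energyAt
    have h2 := D.measurable_errorAt c
    rw [lintegral_add_left (by fun_prop), lintegral_const_mul _ h1,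
      lintegral_const_mul _ (by fun_prop), lintegral_finsetSum _ (by fun_prop),
      energy_eq_lintegral]
    simp only [ofReal_errorProb_eq_lintegral]
  have hG : Measurable fun s => κ * C.energyAt s + lam * ∑ m, C.errorAt c m s := by
    have h1 := C.measurable_energyAt
    have h2 := C.measurable_errorAt c
    fun_prop
  have hmix := measurePreserving_smul_add_smul_stateLaw hSig hab N
  have hGm := hG.comp hmix.measurable
  have h3 := hmix.lintegral_comp hG
  have h4 := lintegral_prod_symm (μ := stateLaw Sig N) (ν := stateLaw Sig N) _ hGm.aemeasurable
  -- With t as the outer variable, some t does no worse than the average.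
  obtain ⟨t, ht⟩ := exists_le_lintegral (μ := stateLaw Sig N)
    (hGm.lintegral_prod_left' (μ := stateLaw Sig N)).aemeasurable
  refine ⟨C.shift c a (b • t), ?_⟩
  rw [hE, hE, ← h3]
  refine le_of_le_of_eq ?_ h4.symm
  simp only [energyAt_shift, errorAt_shift]
  exact ht

end Code

/-! ### Comparison of achievable rates. -/

theorem Achievable.of_mul {M : ℕ} {Sig : Matrix (Fin M) (Fin M) ℝ} (hSig : Sig.PosSemidef)
    {P : ℝ} (hP : 0 ≤ P) {c a R R' : ℝ} (ha : |a| ≤ 1) (hR' : 0 ≤ R') (hlt : R' < R)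
    (h : Achievable Sig P c R) : Achievable Sig P (a * c) R' := by
  intro ε hε
  have hab : a ^ 2 + √(1 - a ^ 2) ^ 2 = 1 := by
    rw [Real.sq_sqrt (by nlinarith [(sq_le_one_iff_abs_le_one a).2 ha])]
    ring
  -- δ is the relative energy excess, paid for by lengthening the block by 1 + δ; η absorbs the
  -- rounding of N / (1 + δ), once R ≤ nη.
  obtain ⟨δ, hδ, η, hη, hrate⟩ : ∃ δ > 0, ∃ η > 0, (1 + δ) * R' + η ≤ R := by
    have h1 : 0 < (R - R') / 2 := by linarith
    refine ⟨(R - R') / 2 / (R' + 1), by positivity, (R - R') / 2, h1, ?_⟩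
    have h2 : (R - R') / 2 / (R' + 1) * R' ≤ (R - R') / 2 := by
      rw [div_mul_eq_mul_div, div_le_iff₀ (by positivity)]
      nlinarith
    linarith
  set lam : ℝ := (1 + δ) / ε with hlam_def
  have hlam : 0 < lam := by positivity
  -- The M errors, weighted by `lam`, add at most δ; M + 1 keeps the denominator nonzero.
  obtain ⟨n₀, hn₀⟩ := h (δ / (lam * (M + 1))) (by positivity)
  refine ⟨⌈((max n₀ ⌈R / η⌉₊ : ℕ) : ℝ) * (1 + δ)⌉₊, fun N hN => ?_⟩
  set n := ⌊(N : ℝ) / (1 + δ)⌋₊ with hn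
  have hn1 : max n₀ ⌈R / η⌉₊ ≤ n :=
    Nat.le_floor ((le_div_iff₀ (by positivity)).2 (Nat.ceil_le.1 hN))
  have hnN : (n : ℝ) * (1 + δ) ≤ N :=
    (le_div_iff₀ (by positivity)).1 (Nat.floor_le (by positivity))
  have hNn : (N : ℝ) < (n + 1) * (1 + δ) :=
    (div_lt_iff₀ (by positivity)).1 (Nat.lt_floor_add_one _)
  have hRn : R ≤ n * η := by
    rw [← div_le_iff₀ hη]
    exact (Nat.le_ceil _).trans (by exact_mod_cast (le_max_right _ _).trans hn1)
  obtain ⟨K, C, hK, hCe, hCerr⟩ := hn₀ n ((le_max_left _ _).trans hn1)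
  -- If nP = 0 the energy weight is ∞: the energy of `C` is 0, so its term is ∞ · 0 = 0, and the
  -- bound forces `D` to use no energy.
  obtain ⟨D, hD⟩ := C.exists_shift_le hSig c hab (ENNReal.ofReal (n * P))⁻¹ (ENNReal.ofReal lam)
  have htot : (ENNReal.ofReal (n * P))⁻¹ * C.energy Sig
      + ENNReal.ofReal lam * ∑ m, ENNReal.ofReal (C.errorProb Sig c m)
        ≤ ENNReal.ofReal (1 + δ) := by
    rw [ENNReal.ofReal_add zero_le_one hδ.le, ENNReal.ofReal_one]
    refine add_le_add ?_ ?_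
    · exact (mul_le_mul_right hCe _).trans (ENNReal.inv_mul_le_one _)
    · refine (mul_le_mul_right (Finset.sum_le_sum fun m _ =>
        ENNReal.ofReal_le_ofReal (hCerr m)) _).trans ?_
      rw [Finset.sum_const, Finset.card_univ, Fintype.card_fin, nsmul_eq_mul,
        ← ENNReal.ofReal_natCast, ← ENNReal.ofReal_mul (by positivity),
        ← ENNReal.ofReal_mul hlam.le]
      refine ENNReal.ofReal_le_ofReal ?_
      rw [show lam * (M * (δ / (lam * (M + 1)))) = δ * (M / (M + 1)) by field_simp]
      exact mul_le_of_le_one_right hδ.le ((div_le_one (by positivity)).2 (by linarith))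
  have hDe := (le_self_add.trans hD).trans htot
  have hDerr := (le_add_self.trans hD).trans htot
  have hnN' : n ≤ N := by
    have : (n : ℝ) ≤ N := by nlinarith [(Nat.cast_nonneg n : (0 : ℝ) ≤ n)]
    exact_mod_cast this
  obtain ⟨k, hk⟩ := Nat.exists_eq_add_of_le hnN'
  clear_value n
  subst hk
  refine ⟨K, D.pad k, ?_, ?_, fun m => ?_⟩
  · refine (Real.rpow_le_rpow_of_exponent_le one_le_two ?_).trans hK
    nlinarith [mul_le_mul_of_nonneg_right hNn.le hR', (Nat.cast_nonneg n : (0 : ℝ) ≤ n)]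
  · rw [Code.energy_pad]
    rw [mul_comm, ← div_eq_mul_inv, ENNReal.div_le_iff_le_mul (.inr ENNReal.ofReal_ne_top)
      (.inl ENNReal.ofReal_ne_top), ← ENNReal.ofReal_mul (by positivity)] at hDe
    refine hDe.trans (ENNReal.ofReal_le_ofReal ?_)
    nlinarith [mul_le_mul_of_nonneg_right hnN hP]
  · rw [Code.errorProb_pad]
    have h1 := (mul_le_mul_right (Finset.single_le_sum
      (f := fun m => ENNReal.ofReal (D.errorProb Sig (a * c) m)) (fun _ _ => zero_le)
      (Finset.mem_univ m)) (ENNReal.ofReal lam)).trans hDerr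
    rw [← ENNReal.ofReal_mul hlam.le, ENNReal.ofReal_le_ofReal_iff (by positivity), hlam_def,
      div_mul_eq_mul_div, div_le_iff₀ hε] at h1
    exact le_of_mul_le_mul_left h1 (by positivity)

end CCDP

theorem mainTheorem5 (M : ℕ) (Sig : Matrix (Fin M) (Fin M) ℝ) (hSig : Sig.PosSemidef)
    (P : ℝ) (hP : 0 ≤ P) (c₁ c₂ : ℝ) (hc : |c₁| ≤ |c₂|) :
    CCDP.capacity Sig P c₂ ≤ CCDP.capacity Sig P c₁ := by
  have ha : |c₁ / c₂| ≤ 1 := by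
    rw [abs_div]
    exact div_le_one_of_le₀ hc (abs_nonneg _)
  -- If c₂ = 0, then c₁ = 0 as well.
  have hmul : c₁ / c₂ * c₂ = c₁ :=
    div_mul_cancel_of_imp fun h => by simpa [h] using hc
  refine sSup_le ?_
  rintro _ ⟨R, ⟨-, hR⟩, rfl⟩
  -- `of_mul` yields only rates strictly below R, which suffices for the supremum.
  refine le_of_forall_lt fun r hr => ?_
  obtain ⟨q, hrq, hqR⟩ := exists_between hr
  have hq : q ≠ ∞ := (hqR.trans_le le_top).ne
  refine hrq.trans_le (le_sSup ⟨q.toReal, ⟨ENNReal.toReal_nonneg, ?_⟩, ENNReal.ofReal_toReal hq⟩)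
  have hlt : q.toReal < R := by
    rwa [ENNReal.lt_ofReal_iff_toReal_lt hq] at hqR
  have := hR.of_mul hSig hP ha ENNReal.toReal_nonneg hlt
  rwa [hmul] at this
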